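/- Let $\mathcal H=\mathbb C^d$ be a finite-dimensional complex Hilbert space. A density matrix is a positive semidefinite $d\times d$ complex matrix of trace one; it is a pure state if it equals $|\psi\rangle\langle\psi|$ for a unit vector $\psi$. For real $p\ge 1$ let $\|A\|_p=\bigl(\operatorname{tr}[(AA^\dagger)^{p/2}]\bigr)^{1/p}$ be the Schatten $p$-norm, and for density matrices $\rho,\sigma$ put $$\mathcal F_p(\rho,\sigma)=\frac{\|\sqrt\rho\sqrt\sigma\|_p^2}{\max\bigl[\|\rho\|_p^2,\|\sigma\|_p^2\bigr]}.$$ Then for every real $p\ge1$ and all density matrices $\rho,\sigma$ on $\mathcal H$, Jozsa's axioms hold: - (J1a) $\mathcal F_p(\rho,\sigma)\in[0,1]$; - (J1b) $\mathcal F_p(\rho,\sigma)=1$ if and only if $\rho=\sigma$; - (J1c) $\mathcal F_p(\rho,\sigma)=0$ if and only if $\rho\sigma=0$; - (J2) $\mathcal F_p(\rho,\sigma)=\mathcal F_p(\sigma,\rho)$; - (J3) $\mathcal F_p(\rho,\sigma)=\operatorname{tr}(\rho\sigma)$ if $\rho$ or $\sigma$ is a pure state; - (J4) $\mathcal F_p(U\rho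 U^\dagger,U\sigma U^\dagger)=\mathcal F_p(\rho,\sigma)$ for every unitary $U$. Moreover, $\mathcal F_1$ is the Uhlmann–Jozsa fidelity: $$\mathcal F_1(\rho,\sigma)=\max_{\psi,\varphi}|\langle\psi|\varphi\rangle|^2=\Bigl(\operatorname{tr}\sqrt{\sqrt\rho\,\sigma\sqrt\rho}\Bigr)^2,$$ where the maximum, which is attained, is over all $m\in\mathbb N$ and all vectors $\psi,\varphi\in\mathbb C^d\otimes\mathbb C^m$ that are purifications of $\rho$ and $\sigma$ respectively, i.e. $\operatorname{tr}_{\mathbb C^m}|\psi\rangle\langle\psi|=\rho$ and $\operatorname{tr}_{\mathbb C^m}|\varphi\rangle\langle\varphi|=\sigma$. -/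

import Mathlib

open scoped Matrix ComplexOrder MatrixOrder

noncomputable section

namespace NormFidelity

variable {d : Type*} [Fintype d] [DecidableEq d]

/-- A density matrix: positive semidefinite (hence Hermitian) with unit trace. -/
def IsDensityMatrix (ρ : Matrix d d ℂ) : Prop :=
  ρ.PosSemidef ∧ ρ.trace = 1

/-- A pure state `|ψ⟩⟨ψ|`, with `ψ` a unit vector. -/
def IsPureState (ρ : Matrix d d ℂ) : Prop :=
  ∃ ψ : d → ℂ, star ψ ⬝ᵥ ψ = 1 ∧ ρ = Matrix.vecMulVec ψ (star ψ)

/-- The Schatten `p`-norm `‖A‖_p = (tr (A A†)^{p/2})^{1/p}`. The power of the positive semidefinite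
matrix `A A†` is the one of the continuous functional calculus; its trace is a nonnegative real. -/
def schattenNorm (p : ℝ) (A : Matrix d d ℂ) : ℝ :=
  ((A * Aᴴ) ^ (p / 2)).trace.re ^ (1 / p)

/-- The norm-based fidelity `F_p(ρ, σ) = ‖√ρ √σ‖_p² / max(‖ρ‖_p², ‖σ‖_p²)`. -/
def normFidelity (p : ℝ) (ρ σ : Matrix d d ℂ) : ℝ :=
  schattenNorm p (CFC.sqrt ρ * CFC.sqrt σ) ^ 2 /
    max (schattenNorm p ρ ^ 2) (schattenNorm p σ ^ 2)

/-- Jozsa's axioms (J1a, J1b, J1c, J2, J3, J4) for a function of pairs of density matrices. -/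
structure JozsaAxioms (F : Matrix d d ℂ → Matrix d d ℂ → ℝ) : Prop where
  j1a : ∀ ρ σ, IsDensityMatrix ρ → IsDensityMatrix σ → F ρ σ ∈ Set.Icc (0 : ℝ) 1
  j1b : ∀ ρ σ, IsDensityMatrix ρ → IsDensityMatrix σ → (F ρ σ = 1 ↔ ρ = σ)
  j1c : ∀ ρ σ, IsDensityMatrix ρ → IsDensityMatrix σ → (F ρ σ = 0 ↔ ρ * σ = 0)
  j2 : ∀ ρ σ, IsDensityMatrix ρ → IsDensityMatrix σ → F ρ σ = F σ ρ
  j3 : ∀ ρ σ, IsDensityMatrix ρ → IsDensityMatrix σ → IsPureState ρ ∨ IsPureState σ →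
    (F ρ σ : ℂ) = (ρ * σ).trace
  j4 : ∀ ρ σ, IsDensityMatrix ρ → IsDensityMatrix σ → ∀ U ∈ Matrix.unitaryGroup d ℂ,
    F (U * ρ * Uᴴ) (U * σ * Uᴴ) = F ρ σ

/-- The partial trace of a matrix on `ℂ^d ⊗ ℂ^e` over the second factor. -/
def partialTrace {e : Type*} [Fintype e] (M : Matrix (d × e) (d × e) ℂ) : Matrix d d ℂ :=
  Matrix.of fun i j => ∑ k, M (i, k) (j, k)

/-- `ψ ∈ ℂ^d ⊗ ℂ^e` is a purification of `ρ`: `tr_{ℂ^e} |ψ⟩⟨ψ| = ρ`. -/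
def IsPurification {e : Type*} [Fintype e] (ψ : d × e → ℂ) (ρ : Matrix d d ℂ) : Prop :=
  partialTrace (Matrix.vecMulVec ψ (star ψ)) = ρ

/-- The transition probabilities `|⟨ψ|φ⟩|²` between purifications `ψ` of `ρ` and `φ` of `σ` in a
common extended space `ℂ^d ⊗ ℂ^m`, of arbitrary finite auxiliary dimension `m`. -/
def transitionProbabilities (ρ σ : Matrix d d ℂ) : Set ℝ :=
  {x | ∃ (m : ℕ) (ψ φ : d × Fin m → ℂ), IsPurification ψ ρ ∧ IsPurification φ σ ∧
    x = ‖star ψ ⬝ᵥ φ‖ ^ 2}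

end NormFidelity

end

namespace NormFidelity

variable {d : Type*} [Fintype d] [DecidableEq d]

/-! Everything is read off a singular value decomposition `√ρ √σ = U S V†`. Expanding the Gram
matrix of `√ρ U - √σ V` gives `U†ρU + V†σV - 2S` (`singular_gap`). It is positive semidefinite, so
each singular value is at most the mean of the corresponding diagonal entries of `U†ρU` and `V†σV`.
Convexity of `x ↦ x ^ p` and Peierls' inequality turn this into `‖√ρ √σ‖_p^p ≤ (‖ρ‖_p^p + ‖σ‖_p^p) /
2`, which is at most the `p`-th power of the larger norm. In case of equality the Gram matrix has
trace zero, so `√ρ U = √σ V`, and multiplying by adjoints gives `ρ = σ`. This is the core of (J1).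
Symmetry and unitary invariance come from those of singular values, and for pure `ρ` everything
reduces to `ρσρ = tr(ρσ) ρ`.

For `p = 1` the denominator is 1 and the fidelity is `(tr S)²`. A purification is a matrix `Ψ` with
`ΨΨ† = ρ`, hence `Ψ = √ρ X` with `X` a contraction. With `Φ = √σ Y` likewise, the overlap is the
trace of `S` times a matrix whose diagonal entries have modulus at most 1, so it is bounded by `tr
S`. The choice `Ψ = √ρ`, `Φ = √σ V U†` attains the bound. -/

/-! ### Unitary diagonalization and traces of functions of a matrix -/

theorem conjTranspose_mul_self_of_mem {U : Matrix d d ℂ} (hU : U ∈ Matrix.unitaryGroup d ℂ) :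
    Uᴴ * U = 1 := (Matrix.mem_unitaryGroup_iff').mp hU

theorem mul_conjTranspose_self_of_mem {U : Matrix d d ℂ} (hU : U ∈ Matrix.unitaryGroup d ℂ) :
    U * Uᴴ = 1 := (Matrix.mem_unitaryGroup_iff).mp hU

theorem conjTranspose_mem {U : Matrix d d ℂ} (hU : U ∈ Matrix.unitaryGroup d ℂ) :
    Uᴴ ∈ Matrix.unitaryGroup d ℂ := Unitary.star_mem hU

/-- The diagonal matrix with the given real entries. -/
abbrev realDiagonal {e : Type*} [DecidableEq e] (t : e → ℝ) : Matrix e e ℂ :=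
  Matrix.diagonal fun i => (t i : ℂ)

theorem conjTranspose_realDiagonal {e : Type*} [DecidableEq e] (t : e → ℝ) :
    (realDiagonal t)ᴴ = realDiagonal t := by
  simp [realDiagonal, Matrix.diagonal_conjTranspose, Pi.star_def]

theorem isHermitian_conj_realDiagonal (U : Matrix d d ℂ) (t : d → ℝ) :
    (U * realDiagonal t * Uᴴ).IsHermitian := by
  simp only [Matrix.IsHermitian, Matrix.conjTranspose_mul, conjTranspose_realDiagonal, mul_assoc,
    Matrix.conjTranspose_conjTranspose]

theorem posSemidef_conj_realDiagonal (U : Matrix d d ℂ) {t : d → ℝ} (ht : ∀ i, 0 ≤ t i) :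
    (U * realDiagonal t * Uᴴ).PosSemidef := by
  refine Matrix.PosSemidef.mul_mul_conjTranspose_same ?_ U
  exact Matrix.PosSemidef.diagonal fun i => by simpa using ht i

/-- Both sides are the roots of the characteristic polynomial, which is invariant under cyclic
permutation of factors. Multisets are compared because the ordering of `eigenvalues` need not be
that of `t`. -/
theorem map_eigenvalues_conj_realDiagonal {U : Matrix d d ℂ} (hU : U ∈ Matrix.unitaryGroup d ℂ)
    (t : d → ℝ) (hA : (U * realDiagonal t * Uᴴ).IsHermitian) :
    Finset.univ.val.map hA.eigenvalues = Finset.univ.val.map t := by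
  have h1 := hA.roots_charpoly_eq_eigenvalues
  rw [Matrix.charpoly_mul_comm, ← mul_assoc, conjTranspose_mul_self_of_mem hU, one_mul,
    Matrix.charpoly_diagonal, Polynomial.roots_prod] at h1
  · simp only [Polynomial.roots_X_sub_C, Multiset.bind_singleton] at h1
    have h2 := congrArg (Multiset.map Complex.re) h1
    simpa [Multiset.map_map, Function.comp_def] using h2.symm
  · simp [Finset.prod_ne_zero_iff, Polynomial.X_sub_C_ne_zero]

theorem trace_cfc_conj_realDiagonal {U : Matrix d d ℂ} (hU : U ∈ Matrix.unitaryGroup d ℂ)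
    (t : d → ℝ) (f : ℝ → ℝ) :
    (cfc f (U * realDiagonal t * Uᴴ)).trace = ((∑ i, f (t i) : ℝ) : ℂ) := by
  have hA := isHermitian_conj_realDiagonal U t
  have h : ∑ i, f (hA.eigenvalues i) = ∑ i, f (t i) := by
    have := congrArg (fun m => (Multiset.map f m).sum) (map_eigenvalues_conj_realDiagonal hU t hA)
    simpa [Multiset.map_map, Function.comp_def] using this
  rw [hA.cfc_eq, Matrix.IsHermitian.cfc, Unitary.conjStarAlgAut_apply, Matrix.trace_mul_comm,
    ← mul_assoc, Unitary.coe_star_mul_self, one_mul, Matrix.trace_diagonal, ← h]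
  simp

/-- The trace of a real power of a positive semidefinite matrix, in diagonalized form. -/
theorem trace_rpow_conj_realDiagonal {U : Matrix d d ℂ} (hU : U ∈ Matrix.unitaryGroup d ℂ)
    {t : d → ℝ} (ht : ∀ i, 0 ≤ t i) (r : ℝ) :
    ((U * realDiagonal t * Uᴴ) ^ r).trace = ((∑ i, t i ^ r : ℝ) : ℂ) := by
  rw [CFC.rpow_eq_cfc_real (ha := (posSemidef_conj_realDiagonal U ht).nonneg),
    trace_cfc_conj_realDiagonal hU]

theorem exists_eq_conj_realDiagonal {A : Matrix d d ℂ} (hA : A.PosSemidef) :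
    ∃ U ∈ Matrix.unitaryGroup d ℂ, ∃ t : d → ℝ, (∀ i, 0 ≤ t i) ∧ A = U * realDiagonal t * Uᴴ :=
  ⟨hA.1.eigenvectorUnitary, SetLike.coe_mem _, hA.1.eigenvalues, hA.eigenvalues_nonneg,
    hA.1.spectral_theorem⟩

/-! ### Singular value decomposition -/

/-- A square matrix with orthogonal columns is a unitary times the diagonal of column norms. -/
theorem exists_eq_unitary_mul_realDiagonal {K : Matrix d d ℂ} {s : d → ℝ}
    (hK : Kᴴ * K = realDiagonal fun i => s i ^ 2) :
    ∃ V ∈ Matrix.unitaryGroup d ℂ, K = V * realDiagonal s := by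
  have hent : ∀ i j, ∑ k, star (K k i) * K k j = if i = j then ((s i : ℂ)) ^ 2 else 0 := by
    intro i j
    have := congrFun (congrFun hK i) j
    simpa [Matrix.mul_apply, Matrix.diagonal_apply] using this
  -- Normalized columns; only those with `s i ≠ 0` are used, and they are completed to an
  -- orthonormal basis, whose vectors are the columns of the unitary.
  let v : d → EuclideanSpace ℂ d := fun i => WithLp.toLp 2 fun k => (s i : ℂ)⁻¹ * K k i
  have hv : Orthonormal ℂ (({i | s i ≠ 0} : Set d).domRestrict v) := by
    rw [orthonormal_iff_ite]
    rintro ⟨i, hi⟩ ⟨j, hj⟩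
    have hi' : (s i : ℂ) ≠ 0 := by exact_mod_cast hi
    have : inner ℂ (v i) (v j) = (s i : ℂ)⁻¹ * (s j : ℂ)⁻¹ * ∑ k, star (K k i) * K k j := by
      simp only [v, PiLp.inner_apply, RCLike.inner_apply, map_mul, map_inv₀, Complex.conj_ofReal,
        Finset.mul_sum]
      refine Finset.sum_congr rfl fun k _ => ?_
      simp only [RCLike.star_def]
      ring
    change inner ℂ (v i) (v j) = _
    simp only [Subtype.mk.injEq, this, hent]
    split_ifs with h
    · subst h
      field_simp
    · simp
  obtain ⟨b, hb⟩ := hv.exists_orthonormalBasis_extension_of_card_eq (by simp)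
  refine ⟨_, (EuclideanSpace.basisFun d ℂ).toMatrix_orthonormalBasis_mem_unitary b, ?_⟩
  ext k i
  rw [Matrix.mul_diagonal]
  have hV : (EuclideanSpace.basisFun d ℂ).toBasis.toMatrix b k i = b i k := rfl
  rw [hV]
  by_cases hs : s i = 0
  · have h0 := hent i i
    simp only [hs, if_true, Complex.ofReal_zero] at h0
    have h1 : ∑ k, ‖K k i‖ ^ 2 = 0 := by
      have : ((∑ k, ‖K k i‖ ^ 2 : ℝ) : ℂ) = 0 := by
        rw [← zero_pow (two_ne_zero), ← h0]
        push_cast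
        refine Finset.sum_congr rfl fun k _ => ?_
        rw [RCLike.star_def, Complex.conj_mul']
      exact_mod_cast this
    rw [Finset.sum_eq_zero_iff_of_nonneg (fun _ _ => by positivity)] at h1
    have := h1 k (Finset.mem_univ k)
    simp_all
  · have hs' : (s i : ℂ) ≠ 0 := by exact_mod_cast hs
    rw [hb i hs]
    simp only [v]
    field_simp

/-- The singular value decomposition of a square complex matrix. -/
theorem exists_singular_value_decomposition (M : Matrix d d ℂ) :
    ∃ U ∈ Matrix.unitaryGroup d ℂ, ∃ V ∈ Matrix.unitaryGroup d ℂ, ∃ s : d → ℝ,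
      (∀ i, 0 ≤ s i) ∧ M = U * realDiagonal s * Vᴴ := by
  obtain ⟨U, hU, t, ht, hM⟩ :=
    exists_eq_conj_realDiagonal (Matrix.posSemidef_self_mul_conjTranspose M)
  -- Since `U` diagonalizes `M Mᴴ`, the columns of `Mᴴ * U` are orthogonal.
  have hK : (Mᴴ * U)ᴴ * (Mᴴ * U) = realDiagonal fun i => √(t i) ^ 2 := by
    have : (Mᴴ * U)ᴴ * (Mᴴ * U) = Uᴴ * (M * Mᴴ) * U := by
      simp [Matrix.conjTranspose_mul, mul_assoc]
    rw [this, hM]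
    simp only [Real.sq_sqrt (ht _)]
    calc _ = (Uᴴ * U) * realDiagonal t * (Uᴴ * U) := by simp only [mul_assoc]
      _ = _ := by simp [conjTranspose_mul_self_of_mem hU]
  obtain ⟨V, hV, h⟩ := exists_eq_unitary_mul_realDiagonal hK
  refine ⟨U, hU, V, hV, fun i => √(t i), fun i => Real.sqrt_nonneg _, ?_⟩
  have h2 := congrArg (fun X => U * Xᴴ) h
  simp only [Matrix.conjTranspose_mul, conjTranspose_realDiagonal,
    Matrix.conjTranspose_conjTranspose] at h2
  rw [← mul_assoc, mul_conjTranspose_self_of_mem hU, one_mul, ← mul_assoc] at h2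
  exact h2

theorem mul_conjTranspose_of_svd {U V : Matrix d d ℂ} (hV : V ∈ Matrix.unitaryGroup d ℂ)
    (s : d → ℝ) :
    (U * realDiagonal s * Vᴴ) * (U * realDiagonal s * Vᴴ)ᴴ =
      U * realDiagonal (fun i => s i ^ 2) * Uᴴ := by
  have : realDiagonal (fun i => s i ^ 2) = realDiagonal s * realDiagonal s := by
    simp [realDiagonal, Matrix.diagonal_mul_diagonal, sq]
  rw [this]
  simp only [Matrix.conjTranspose_mul, conjTranspose_realDiagonal,
    Matrix.conjTranspose_conjTranspose, mul_assoc]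
  rw [← mul_assoc Vᴴ V, conjTranspose_mul_self_of_mem hV, one_mul]

/-! ### Schatten norms through singular values -/

/-- The Schatten norm in terms of singular values. -/
theorem schattenNorm_of_svd {U V : Matrix d d ℂ} (hU : U ∈ Matrix.unitaryGroup d ℂ)
    (hV : V ∈ Matrix.unitaryGroup d ℂ) {s : d → ℝ} (hs : ∀ i, 0 ≤ s i) (p : ℝ) :
    schattenNorm p (U * realDiagonal s * Vᴴ) = (∑ i, s i ^ p) ^ (1 / p) := by
  rw [schattenNorm, mul_conjTranspose_of_svd hV,
    trace_rpow_conj_realDiagonal hU (fun i => sq_nonneg _), Complex.ofReal_re]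
  congr 1
  refine Finset.sum_congr rfl fun i _ => ?_
  rw [← Real.rpow_natCast, ← Real.rpow_mul (hs i)]
  congr 1
  push_cast
  ring

theorem schattenNorm_nonneg (p : ℝ) (A : Matrix d d ℂ) : 0 ≤ schattenNorm p A := by
  obtain ⟨U, hU, V, hV, s, hs, rfl⟩ := exists_singular_value_decomposition A
  rw [schattenNorm_of_svd hU hV hs]
  exact Real.rpow_nonneg (Finset.sum_nonneg fun i _ => Real.rpow_nonneg (hs i) _) _

theorem schattenNorm_conjTranspose (p : ℝ) (A : Matrix d d ℂ) :
    schattenNorm p Aᴴ = schattenNorm p A := by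
  obtain ⟨U, hU, V, hV, s, hs, rfl⟩ := exists_singular_value_decomposition A
  have : (U * realDiagonal s * Vᴴ)ᴴ = V * realDiagonal s * Uᴴ := by
    simp only [Matrix.conjTranspose_mul, conjTranspose_realDiagonal, mul_assoc,
      Matrix.conjTranspose_conjTranspose]
  rw [this, schattenNorm_of_svd hU hV hs, schattenNorm_of_svd hV hU hs]

theorem schattenNorm_unitary_conj (p : ℝ) (A : Matrix d d ℂ) {W : Matrix d d ℂ}
    (hW : W ∈ Matrix.unitaryGroup d ℂ) : schattenNorm p (W * A * Wᴴ) = schattenNorm p A := by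
  obtain ⟨U, hU, V, hV, s, hs, rfl⟩ := exists_singular_value_decomposition A
  have : W * (U * realDiagonal s * Vᴴ) * Wᴴ = (W * U) * realDiagonal s * (W * V)ᴴ := by
    simp [Matrix.conjTranspose_mul, mul_assoc]
  rw [this, schattenNorm_of_svd hU hV hs,
    schattenNorm_of_svd (mul_mem hW hU) (mul_mem hW hV) hs]

theorem schattenNorm_eq_zero_iff {p : ℝ} (hp : 0 < p) {A : Matrix d d ℂ} :
    schattenNorm p A = 0 ↔ A = 0 := by
  obtain ⟨U, hU, V, hV, s, hs, rfl⟩ := exists_singular_value_decomposition A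
  rw [schattenNorm_of_svd hU hV hs]
  have hnn : ∀ i ∈ Finset.univ, 0 ≤ s i ^ p := fun i _ => Real.rpow_nonneg (hs i) _
  rw [Real.rpow_eq_zero (Finset.sum_nonneg hnn) (by positivity),
    Finset.sum_eq_zero_iff_of_nonneg hnn]
  constructor
  · intro h
    have : s = 0 := by
      ext i
      exact (Real.rpow_eq_zero (hs i) hp.ne').mp (h i (Finset.mem_univ i))
    simp [this, realDiagonal]
  · intro h i _
    have h2 := congrArg (fun X => Uᴴ * X * V) h
    have h3 : Uᴴ * (U * realDiagonal s * Vᴴ) * V = realDiagonal s := by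
      calc _ = (Uᴴ * U) * realDiagonal s * (Vᴴ * V) := by simp only [mul_assoc]
        _ = _ := by simp [conjTranspose_mul_self_of_mem hU, conjTranspose_mul_self_of_mem hV]
    simp only [h3, mul_zero, zero_mul] at h2
    have := congrFun (congrFun h2 i) i
    rw [Real.rpow_eq_zero (hs i) hp.ne']
    simpa using this

/-! ### Diagonal entries and Peierls' inequality -/

/-- For unitary `Q` the weights `‖Q i j‖ ^ 2` are doubly stochastic: Jensen's inequality uses the
row sums, and the final summation over `i` uses the column sums. -/
theorem re_diag_conj_realDiagonal (Q : Matrix d d ℂ) (t : d → ℝ) (i : d) :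
    ((Q * realDiagonal t * Qᴴ) i i).re = ∑ j, ‖Q i j‖ ^ 2 * t j := by
  rw [Matrix.mul_apply, Complex.re_sum]
  refine Finset.sum_congr rfl fun j _ => ?_
  have : (Q * realDiagonal t) i j * Qᴴ j i = ((‖Q i j‖ ^ 2 * t j : ℝ) : ℂ) := by
    rw [Matrix.mul_diagonal, Matrix.conjTranspose_apply, mul_right_comm, RCLike.star_def,
      Complex.mul_conj']
    push_cast
    rfl
  rw [this, Complex.ofReal_re]

theorem sum_norm_sq_row {Q : Matrix d d ℂ} (hQ : Q ∈ Matrix.unitaryGroup d ℂ) (i : d) :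
    ∑ j, ‖Q i j‖ ^ 2 = 1 := by
  have h := re_diag_conj_realDiagonal Q (fun _ => 1) i
  have h1 : realDiagonal (fun _ : d => (1 : ℝ)) = 1 := by simp [realDiagonal]
  rw [h1, mul_one, mul_conjTranspose_self_of_mem hQ] at h
  simpa using h.symm

theorem sum_norm_sq_col {Q : Matrix d d ℂ} (hQ : Q ∈ Matrix.unitaryGroup d ℂ) (j : d) :
    ∑ i, ‖Q i j‖ ^ 2 = 1 := by
  simpa [Matrix.conjTranspose_apply] using sum_norm_sq_row (conjTranspose_mem hQ) j

/-- Peierls' inequality: the `p`-th powers of the diagonal entries of a positive semidefinite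
matrix in any orthonormal basis sum to at most the sum of the `p`-th powers of its eigenvalues. -/
theorem sum_rpow_diag_le {U W : Matrix d d ℂ} (hU : U ∈ Matrix.unitaryGroup d ℂ)
    (hW : W ∈ Matrix.unitaryGroup d ℂ) {t : d → ℝ} (ht : ∀ i, 0 ≤ t i) {p : ℝ} (hp : 1 ≤ p) :
    ∑ i, ((Uᴴ * (W * realDiagonal t * Wᴴ) * U) i i).re ^ p ≤ ∑ i, t i ^ p := by
  have hQ : Uᴴ * W ∈ Matrix.unitaryGroup d ℂ := mul_mem (conjTranspose_mem hU) hW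
  have hconj : Uᴴ * (W * realDiagonal t * Wᴴ) * U = (Uᴴ * W) * realDiagonal t * (Uᴴ * W)ᴴ := by
    simp only [Matrix.conjTranspose_mul, Matrix.conjTranspose_conjTranspose, mul_assoc]
  rw [hconj]
  set Q := Uᴴ * W
  calc ∑ i, ((Q * realDiagonal t * Qᴴ) i i).re ^ p
      ≤ ∑ i, ∑ j, ‖Q i j‖ ^ 2 * t j ^ p := by
        refine Finset.sum_le_sum fun i _ => ?_
        rw [re_diag_conj_realDiagonal]
        exact Real.rpow_arith_mean_le_arith_mean_rpow _ _ _ (fun _ _ => by positivity)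
          (sum_norm_sq_row hQ i) (fun j _ => ht j) hp
    _ = ∑ j, t j ^ p := by
        rw [Finset.sum_comm]
        refine Finset.sum_congr rfl fun j _ => ?_
        rw [← Finset.sum_mul, sum_norm_sq_col hQ, one_mul]

theorem re_diag_nonneg {e : Type*} {A : Matrix e e ℂ} (hA : A.PosSemidef) (i : e) :
    0 ≤ (A i i).re :=
  (Complex.nonneg_iff.mp hA.diag_nonneg).1

/-! ### The arithmetic-geometric mean inequality and its equality case -/

/-- The gap in the arithmetic-geometric mean inequality for singular values of a product. -/
theorem singular_gap {A B U V : Matrix d d ℂ} (hA : Aᴴ = A) (hB : Bᴴ = B)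
    (hU : U ∈ Matrix.unitaryGroup d ℂ) (hV : V ∈ Matrix.unitaryGroup d ℂ) {s : d → ℝ}
    (hM : A * B = U * realDiagonal s * Vᴴ) :
    (A * U - B * V)ᴴ * (A * U - B * V) =
      Uᴴ * (A * A) * U + Vᴴ * (B * B) * V - realDiagonal s - realDiagonal s := by
  have h1 : Uᴴ * (A * B) * V = realDiagonal s := by
    rw [hM]
    calc _ = (Uᴴ * U) * realDiagonal s * (Vᴴ * V) := by simp only [mul_assoc]
      _ = _ := by simp [conjTranspose_mul_self_of_mem hU, conjTranspose_mul_self_of_mem hV]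
  have h2 : Vᴴ * (B * A) * U = realDiagonal s := by
    have := congrArg Matrix.conjTranspose h1
    rw [conjTranspose_realDiagonal] at this
    rw [← this]
    simp only [Matrix.conjTranspose_mul, Matrix.conjTranspose_conjTranspose, hA, hB, mul_assoc]
  -- The two copies of the diagonal matrix are replaced by the two different cross terms of the
  -- expanded square.
  nth_rewrite 1 [← h1]
  rw [← h2, Matrix.conjTranspose_sub, Matrix.conjTranspose_mul, Matrix.conjTranspose_mul, hA, hB]
  noncomm_ring

theorem sqrt_posSemidef (ρ : Matrix d d ℂ) : (CFC.sqrt ρ).PosSemidef :=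
  Matrix.nonneg_iff_posSemidef.mp (CFC.sqrt_nonneg ρ)

theorem sqrt_mul_sqrt {ρ : Matrix d d ℂ} (hρ : ρ.PosSemidef) : CFC.sqrt ρ * CFC.sqrt ρ = ρ :=
  CFC.sqrt_mul_sqrt_self ρ hρ.nonneg

theorem sqrt_conjTranspose (ρ : Matrix d d ℂ) : (CFC.sqrt ρ)ᴴ = CFC.sqrt ρ :=
  (sqrt_posSemidef ρ).1

/-- The singular values `s` of `√ρ √σ` and the eigenvalues `t`, `r` of `ρ`, `σ` satisfy
`∑ sᵖ ≤ (∑ tᵖ + ∑ rᵖ) / 2`, with equality only for `ρ = σ`. -/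
theorem sum_singular_rpow_le {ρ σ : Matrix d d ℂ} (hρ : ρ.PosSemidef) (hσ : σ.PosSemidef)
    {U V W Z : Matrix d d ℂ} (hU : U ∈ Matrix.unitaryGroup d ℂ) (hV : V ∈ Matrix.unitaryGroup d ℂ)
    (hW : W ∈ Matrix.unitaryGroup d ℂ) (hZ : Z ∈ Matrix.unitaryGroup d ℂ) {s t r : d → ℝ}
    (hs : ∀ i, 0 ≤ s i) (ht : ∀ i, 0 ≤ t i) (hr : ∀ i, 0 ≤ r i)
    (hM : CFC.sqrt ρ * CFC.sqrt σ = U * realDiagonal s * Vᴴ)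
    (hρW : ρ = W * realDiagonal t * Wᴴ) (hσZ : σ = Z * realDiagonal r * Zᴴ)
    {p : ℝ} (hp : 1 ≤ p) :
    ∑ i, s i ^ p ≤ (∑ i, t i ^ p + ∑ i, r i ^ p) / 2 ∧
      (∑ i, s i ^ p = (∑ i, t i ^ p + ∑ i, r i ^ p) / 2 → ρ = σ) := by
  have hgap := singular_gap (sqrt_conjTranspose ρ) (sqrt_conjTranspose σ) hU hV hM
  rw [sqrt_mul_sqrt hρ, sqrt_mul_sqrt hσ] at hgap
  set D := CFC.sqrt ρ * U - CFC.sqrt σ * V with hD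
  let x : d → ℝ := fun i => ((Uᴴ * ρ * U) i i).re
  let y : d → ℝ := fun i => ((Vᴴ * σ * V) i i).re
  have hx : ∀ i, 0 ≤ x i := re_diag_nonneg (hρ.conjTranspose_mul_mul_same U)
  have hy : ∀ i, 0 ≤ y i := re_diag_nonneg (hσ.conjTranspose_mul_mul_same V)
  have hgap_diag : ∀ i, ((Dᴴ * D) i i).re = x i + y i - 2 * s i := by
    intro i
    rw [hgap]
    simp only [Matrix.sub_apply, Matrix.add_apply, Complex.sub_re, Complex.add_re,
      Matrix.diagonal_apply_eq, Complex.ofReal_re, x, y]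
    ring
  have hsle : ∀ i, s i ≤ (x i + y i) / 2 := fun i => by
    have := re_diag_nonneg (Matrix.posSemidef_conjTranspose_mul_self D) i
    rw [hgap_diag] at this
    linarith
  have hp0 : 0 < p := by linarith
  have h1 : ∀ i ∈ Finset.univ, s i ^ p ≤ ((x i + y i) / 2) ^ p := fun i _ =>
    Real.rpow_le_rpow (hs i) (hsle i) hp0.le
  have h2 : ∀ i, ((x i + y i) / 2) ^ p ≤ (x i ^ p + y i ^ p) / 2 := fun i => by
    have h := (convexOn_rpow hp).2 (hx i) (hy i) (by norm_num : (0 : ℝ) ≤ 1 / 2)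
      (by norm_num : (0 : ℝ) ≤ 1 / 2) (by norm_num)
    simp only [smul_eq_mul] at h
    calc ((x i + y i) / 2) ^ p = (1 / 2 * x i + 1 / 2 * y i) ^ p := by congr 1; ring
      _ ≤ _ := h
      _ = _ := by ring
  have hxp : ∑ i, x i ^ p ≤ ∑ i, t i ^ p := by
    have := sum_rpow_diag_le hU hW ht hp
    rwa [← hρW] at this
  have hyp : ∑ i, y i ^ p ≤ ∑ i, r i ^ p := by
    have := sum_rpow_diag_le hV hZ hr hp
    rwa [← hσZ] at this
  have h3 : ∑ i, ((x i + y i) / 2) ^ p ≤ (∑ i, t i ^ p + ∑ i, r i ^ p) / 2 := by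
    calc _ ≤ ∑ i, (x i ^ p + y i ^ p) / 2 := Finset.sum_le_sum fun i _ => h2 i
      _ = (∑ i, x i ^ p + ∑ i, y i ^ p) / 2 := by
        rw [← Finset.sum_add_distrib, Finset.sum_div]
      _ ≤ _ := by linarith
  refine ⟨(Finset.sum_le_sum h1).trans h3, fun heq => ?_⟩
  -- Equality is exploited only in `s i ≤ (x i + y i) / 2`, through injectivity of the power on
  -- nonnegative reals; strict convexity, which fails at `p = 1`, is not needed.
  have h4 : ∑ i, s i ^ p = ∑ i, ((x i + y i) / 2) ^ p :=
    le_antisymm (Finset.sum_le_sum h1) (h3.trans heq.ge)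
  have h5 := (Finset.sum_eq_sum_iff_of_le h1).mp h4
  have h6 : ∀ i, s i = (x i + y i) / 2 := fun i =>
    (Real.rpow_left_inj (hs i) (by linarith [hx i, hy i]) hp0.ne').mp (h5 i (Finset.mem_univ i))
  have hDpsd := Matrix.posSemidef_conjTranspose_mul_self D
  have h7 : (Dᴴ * D).trace = 0 := by
    rw [Matrix.trace]
    refine Finset.sum_eq_zero fun i _ => ?_
    have hre : ((Dᴴ * D) i i).re = 0 := by rw [hgap_diag, h6 i]; ring
    have him := (Complex.nonneg_iff.mp (hDpsd.diag_nonneg (i := i))).2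
    exact Complex.ext hre him.symm
  have h8 : D = 0 := Matrix.trace_conjTranspose_mul_self_eq_zero_iff.mp h7
  have h9 : CFC.sqrt ρ * U = CFC.sqrt σ * V := sub_eq_zero.mp h8
  -- Multiplying each side by its adjoint cancels the unitaries and squares the roots.
  have h10 := congrArg (fun X => X * Xᴴ) h9
  simp only [Matrix.conjTranspose_mul, sqrt_conjTranspose] at h10
  have h11 : ∀ (A : Matrix d d ℂ) {Q : Matrix d d ℂ}, Q ∈ Matrix.unitaryGroup d ℂ →
      A * Q * (Qᴴ * A) = A * A := fun A Q hQ => by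
    calc A * Q * (Qᴴ * A) = A * (Q * Qᴴ) * A := by simp only [mul_assoc]
      _ = _ := by rw [mul_conjTranspose_self_of_mem hQ, mul_one]
  rwa [h11 _ hU, h11 _ hV, sqrt_mul_sqrt hρ, sqrt_mul_sqrt hσ] at h10

/-- `∑ sᵖ` over the singular values recovers the Schatten norm. -/
theorem schattenNorm_rpow_of_svd {U V : Matrix d d ℂ} (hU : U ∈ Matrix.unitaryGroup d ℂ)
    (hV : V ∈ Matrix.unitaryGroup d ℂ) {s : d → ℝ} (hs : ∀ i, 0 ≤ s i) {p : ℝ} (hp : 0 < p) :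
    schattenNorm p (U * realDiagonal s * Vᴴ) ^ p = ∑ i, s i ^ p := by
  rw [schattenNorm_of_svd hU hV hs, ← Real.rpow_mul
    (Finset.sum_nonneg fun i _ => Real.rpow_nonneg (hs i) _), one_div_mul_cancel hp.ne',
    Real.rpow_one]

/-- The Schatten-norm form of the arithmetic-geometric mean inequality, with equality case. -/
theorem schattenNorm_sqrt_mul_sqrt_rpow_le {ρ σ : Matrix d d ℂ} (hρ : ρ.PosSemidef)
    (hσ : σ.PosSemidef) {p : ℝ} (hp : 1 ≤ p) :
    schattenNorm p (CFC.sqrt ρ * CFC.sqrt σ) ^ p ≤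
        (schattenNorm p ρ ^ p + schattenNorm p σ ^ p) / 2 ∧
      (schattenNorm p (CFC.sqrt ρ * CFC.sqrt σ) ^ p =
        (schattenNorm p ρ ^ p + schattenNorm p σ ^ p) / 2 → ρ = σ) := by
  have hp0 : 0 < p := by linarith
  obtain ⟨U, hU, V, hV, s, hs, hM⟩ :=
    exists_singular_value_decomposition (CFC.sqrt ρ * CFC.sqrt σ)
  obtain ⟨W, hW, t, ht, hρW⟩ := exists_eq_conj_realDiagonal hρ
  obtain ⟨Z, hZ, r, hr, hσZ⟩ := exists_eq_conj_realDiagonal hσ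
  have h := sum_singular_rpow_le hρ hσ hU hV hW hZ hs ht hr hM hρW hσZ hp
  have e1 : schattenNorm p (CFC.sqrt ρ * CFC.sqrt σ) ^ p = ∑ i, s i ^ p := by
    rw [hM, schattenNorm_rpow_of_svd hU hV hs hp0]
  have e2 : schattenNorm p ρ ^ p = ∑ i, t i ^ p := by
    rw [hρW, schattenNorm_rpow_of_svd hW hW ht hp0]
  have e3 : schattenNorm p σ ^ p = ∑ i, r i ^ p := by
    rw [hσZ, schattenNorm_rpow_of_svd hZ hZ hr hp0]
  rwa [e1, e2, e3]

/-! ### Axioms (J1), (J2) and (J4) -/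

theorem IsDensityMatrix.ne_zero {e : Type*} [Fintype e] {ρ : Matrix e e ℂ}
    (hρ : IsDensityMatrix ρ) : ρ ≠ 0 := by
  rintro rfl
  simpa using hρ.2

theorem IsDensityMatrix.schattenNorm_pos {ρ : Matrix d d ℂ} (hρ : IsDensityMatrix ρ) {p : ℝ}
    (hp : 0 < p) : 0 < schattenNorm p ρ :=
  (schattenNorm_nonneg p ρ).lt_of_ne' fun h => hρ.ne_zero ((schattenNorm_eq_zero_iff hp).mp h)

theorem max_sq_eq {a b : ℝ} (ha : 0 ≤ a) (hb : 0 ≤ b) : max (a ^ 2) (b ^ 2) = max a b ^ 2 := by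
  rcases le_total a b with h | h
  · rw [max_eq_right h, max_eq_right (by gcongr)]
  · rw [max_eq_left h, max_eq_left (by gcongr)]

theorem normFidelity_eq_div_sq (p : ℝ) (ρ σ : Matrix d d ℂ) :
    normFidelity p ρ σ = (schattenNorm p (CFC.sqrt ρ * CFC.sqrt σ) /
      max (schattenNorm p ρ) (schattenNorm p σ)) ^ 2 := by
  rw [normFidelity, max_sq_eq (schattenNorm_nonneg _ _) (schattenNorm_nonneg _ _), div_pow]

theorem rpow_mean_le_max_rpow {a b p : ℝ} (ha : 0 ≤ a) (hb : 0 ≤ b) (hp : 0 ≤ p) :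
    (a ^ p + b ^ p) / 2 ≤ max a b ^ p := by
  have h1 := Real.rpow_le_rpow ha (le_max_left a b) hp
  have h2 := Real.rpow_le_rpow hb (le_max_right a b) hp
  linarith

theorem schattenNorm_sqrt_mul_sqrt_le_max {ρ σ : Matrix d d ℂ} (hρ : ρ.PosSemidef)
    (hσ : σ.PosSemidef) {p : ℝ} (hp : 1 ≤ p) :
    schattenNorm p (CFC.sqrt ρ * CFC.sqrt σ) ≤ max (schattenNorm p ρ) (schattenNorm p σ) := by
  have hp0 : 0 < p := by linarith
  rw [← Real.rpow_le_rpow_iff (schattenNorm_nonneg _ _)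
    (le_max_of_le_left (schattenNorm_nonneg _ _)) hp0]
  exact (schattenNorm_sqrt_mul_sqrt_rpow_le hρ hσ hp).1.trans
    (rpow_mean_le_max_rpow (schattenNorm_nonneg _ _) (schattenNorm_nonneg _ _) hp0.le)

theorem eq_of_schattenNorm_sqrt_mul_sqrt_eq_max {ρ σ : Matrix d d ℂ} (hρ : ρ.PosSemidef)
    (hσ : σ.PosSemidef) {p : ℝ} (hp : 1 ≤ p)
    (h : schattenNorm p (CFC.sqrt ρ * CFC.sqrt σ) = max (schattenNorm p ρ) (schattenNorm p σ)) :
    ρ = σ := by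
  have hle := schattenNorm_sqrt_mul_sqrt_rpow_le hρ hσ hp
  refine hle.2 (le_antisymm hle.1 ?_)
  rw [h]
  exact rpow_mean_le_max_rpow (schattenNorm_nonneg _ _) (schattenNorm_nonneg _ _) (by linarith)

theorem normFidelity_mem_Icc {p : ℝ} (hp : 1 ≤ p) {ρ σ : Matrix d d ℂ}
    (hρ : IsDensityMatrix ρ) (hσ : IsDensityMatrix σ) :
    normFidelity p ρ σ ∈ Set.Icc (0 : ℝ) 1 := by
  have hmax : 0 < max (schattenNorm p ρ) (schattenNorm p σ) :=
    lt_max_of_lt_left (hρ.schattenNorm_pos (by linarith))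
  rw [normFidelity_eq_div_sq]
  refine ⟨sq_nonneg _, pow_le_one₀ (div_nonneg (schattenNorm_nonneg _ _) hmax.le) ?_⟩
  exact (div_le_one hmax).mpr (schattenNorm_sqrt_mul_sqrt_le_max hρ.1 hσ.1 hp)

theorem normFidelity_eq_one_iff {p : ℝ} (hp : 1 ≤ p) {ρ σ : Matrix d d ℂ}
    (hρ : IsDensityMatrix ρ) (hσ : IsDensityMatrix σ) : normFidelity p ρ σ = 1 ↔ ρ = σ := by
  have hmax : 0 < max (schattenNorm p ρ) (schattenNorm p σ) :=
    lt_max_of_lt_left (hρ.schattenNorm_pos (by linarith))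
  rw [normFidelity_eq_div_sq,
    pow_eq_one_iff_of_nonneg (div_nonneg (schattenNorm_nonneg _ _) hmax.le) two_ne_zero,
    div_eq_one_iff_eq hmax.ne']
  refine ⟨eq_of_schattenNorm_sqrt_mul_sqrt_eq_max hρ.1 hσ.1 hp, ?_⟩
  rintro rfl
  rw [sqrt_mul_sqrt hρ.1, max_self]

theorem sqrt_mul_sqrt_eq_zero_iff {ρ σ : Matrix d d ℂ} (hρ : ρ.PosSemidef) (hσ : σ.PosSemidef) :
    CFC.sqrt ρ * CFC.sqrt σ = 0 ↔ ρ * σ = 0 := by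
  constructor
  · intro h
    rw [← sqrt_mul_sqrt hρ, ← sqrt_mul_sqrt hσ, mul_assoc, ← mul_assoc (CFC.sqrt ρ) (CFC.sqrt σ), h,
      zero_mul, mul_zero]
  · intro h
    have h1 : (CFC.sqrt ρ)ᴴ * CFC.sqrt ρ * (CFC.sqrt σ * (CFC.sqrt σ)ᴴ) = 0 := by
      rw [sqrt_conjTranspose, sqrt_conjTranspose, sqrt_mul_sqrt hρ, sqrt_mul_sqrt hσ, h]
    -- `AᴴA X = 0` forces `A X = 0`, and symmetrically on the right, so one root is cancelled on
    -- each side.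
    rw [Matrix.conjTranspose_mul_self_mul_eq_zero, Matrix.mul_self_mul_conjTranspose_eq_zero] at h1
    exact h1

theorem normFidelity_eq_zero_iff {p : ℝ} (hp : 1 ≤ p) {ρ σ : Matrix d d ℂ}
    (hρ : IsDensityMatrix ρ) (hσ : IsDensityMatrix σ) : normFidelity p ρ σ = 0 ↔ ρ * σ = 0 := by
  have hmax : 0 < max (schattenNorm p ρ) (schattenNorm p σ) :=
    lt_max_of_lt_left (hρ.schattenNorm_pos (by linarith))
  rw [normFidelity_eq_div_sq, sq_eq_zero_iff, div_eq_zero_iff, or_iff_left hmax.ne',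
    schattenNorm_eq_zero_iff (by linarith), sqrt_mul_sqrt_eq_zero_iff hρ.1 hσ.1]

theorem normFidelity_comm (p : ℝ) (ρ σ : Matrix d d ℂ) :
    normFidelity p ρ σ = normFidelity p σ ρ := by
  rw [normFidelity, normFidelity, max_comm, ← schattenNorm_conjTranspose p (_ * _),
    Matrix.conjTranspose_mul, sqrt_conjTranspose, sqrt_conjTranspose]

theorem sqrt_unitary_conj {ρ U : Matrix d d ℂ} (hρ : ρ.PosSemidef)
    (hU : U ∈ Matrix.unitaryGroup d ℂ) : CFC.sqrt (U * ρ * Uᴴ) = U * CFC.sqrt ρ * Uᴴ := by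
  refine CFC.sqrt_unique ?_ ((sqrt_posSemidef ρ).mul_mul_conjTranspose_same U).nonneg
  calc _ = U * CFC.sqrt ρ * (Uᴴ * U) * CFC.sqrt ρ * Uᴴ := by simp only [mul_assoc]
    _ = U * (CFC.sqrt ρ * CFC.sqrt ρ) * Uᴴ := by
      rw [conjTranspose_mul_self_of_mem hU, mul_one, mul_assoc U]
    _ = _ := by rw [sqrt_mul_sqrt hρ]

theorem normFidelity_unitary_conj (p : ℝ) {ρ σ U : Matrix d d ℂ} (hρ : ρ.PosSemidef)
    (hσ : σ.PosSemidef) (hU : U ∈ Matrix.unitaryGroup d ℂ) :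
    normFidelity p (U * ρ * Uᴴ) (U * σ * Uᴴ) = normFidelity p ρ σ := by
  have h : U * CFC.sqrt ρ * Uᴴ * (U * CFC.sqrt σ * Uᴴ) = U * (CFC.sqrt ρ * CFC.sqrt σ) * Uᴴ := by
    calc _ = U * CFC.sqrt ρ * (Uᴴ * U) * CFC.sqrt σ * Uᴴ := by simp only [mul_assoc]
      _ = _ := by rw [conjTranspose_mul_self_of_mem hU, mul_one, mul_assoc U]
  simp only [normFidelity, sqrt_unitary_conj hρ hU, sqrt_unitary_conj hσ hU, h,
    schattenNorm_unitary_conj p _ hU]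

/-! ### Axiom (J3): pure states -/

theorem trace_conj_realDiagonal {U : Matrix d d ℂ} (hU : U ∈ Matrix.unitaryGroup d ℂ)
    (t : d → ℝ) : (U * realDiagonal t * Uᴴ).trace = ((∑ i, t i : ℝ) : ℂ) := by
  rw [Matrix.trace_mul_comm, ← mul_assoc, conjTranspose_mul_self_of_mem hU, one_mul,
    Matrix.trace_diagonal]
  push_cast
  rfl

/-- The eigenvalues `t i` of a projection are 0 or 1, so `(c * t i) ^ r = c ^ r * t i`. The
condition `r ≠ 0` excludes the convention `0 ^ 0 = 1`. -/
theorem trace_rpow_smul_projection {P : Matrix d d ℂ} (hP : P.PosSemidef) (hPP : P * P = P)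
    {c : ℝ} (hc : 0 ≤ c) {r : ℝ} (hr : r ≠ 0) :
    (((c : ℂ) • P) ^ r).trace = ((c ^ r : ℝ) : ℂ) * P.trace := by
  obtain ⟨W, hW, t, ht, rfl⟩ := exists_eq_conj_realDiagonal hP
  have ht2 : ∀ i, t i = 0 ∨ t i = 1 := by
    intro i
    have h1 : Wᴴ * (W * realDiagonal t * Wᴴ * (W * realDiagonal t * Wᴴ)) * W =
        Wᴴ * (W * realDiagonal t * Wᴴ) * W := by rw [hPP]
    have h2 : Wᴴ * (W * realDiagonal t * Wᴴ * (W * realDiagonal t * Wᴴ)) * W =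
        (Wᴴ * W) * realDiagonal t * (Wᴴ * W) * realDiagonal t * (Wᴴ * W) := by
      simp only [mul_assoc]
    have h3 : Wᴴ * (W * realDiagonal t * Wᴴ) * W =
        (Wᴴ * W) * realDiagonal t * (Wᴴ * W) := by simp only [mul_assoc]
    rw [h2, h3, conjTranspose_mul_self_of_mem hW, one_mul, mul_one, mul_one,
      Matrix.diagonal_mul_diagonal] at h1
    have h4 := congrFun (congrFun h1 i) i
    simp only [realDiagonal, Matrix.diagonal_apply_eq] at h4
    have h5 : t i * t i = t i := by exact_mod_cast h4
    rcases eq_or_ne (t i) 0 with h | h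
    · exact Or.inl h
    · exact Or.inr (mul_left_cancel₀ h (by rw [h5, mul_one]))
  have hsm : (c : ℂ) • (W * realDiagonal t * Wᴴ) = W * realDiagonal (fun i => c * t i) * Wᴴ := by
    have : realDiagonal (fun i => c * t i) = (c : ℂ) • realDiagonal t := by
      ext i j
      by_cases h : i = j <;> simp [realDiagonal, h]
    rw [this, Matrix.mul_smul, Matrix.smul_mul]
  rw [hsm, trace_rpow_conj_realDiagonal hW (fun i => mul_nonneg hc (ht i)),
    trace_conj_realDiagonal hW, ← Complex.ofReal_mul, Finset.mul_sum]
  congr 1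
  refine Finset.sum_congr rfl fun i _ => ?_
  rcases ht2 i with h | h <;> simp [h, Real.zero_rpow hr]

/-- The eigenvalues lie in `[0, 1]` and sum to 1, so raising them to a power `p ≥ 1` can only
decrease the sum. -/
theorem IsDensityMatrix.schattenNorm_le_one {σ : Matrix d d ℂ} (hσ : IsDensityMatrix σ) {p : ℝ}
    (hp : 1 ≤ p) : schattenNorm p σ ≤ 1 := by
  obtain ⟨hpsd, htr⟩ := hσ
  obtain ⟨W, hW, t, ht, rfl⟩ := exists_eq_conj_realDiagonal hpsd
  rw [trace_conj_realDiagonal hW] at htr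
  have hsum : ∑ i, t i = 1 := by exact_mod_cast htr
  rw [schattenNorm_of_svd hW hW ht]
  refine Real.rpow_le_one (Finset.sum_nonneg fun i _ => Real.rpow_nonneg (ht i) _) ?_
    (by positivity)
  rw [← hsum]
  refine Finset.sum_le_sum fun i _ => ?_
  have hle : t i ≤ 1 := hsum ▸ Finset.single_le_sum (fun j _ => ht j) (Finset.mem_univ i)
  calc t i ^ p ≤ t i ^ (1 : ℝ) := Real.rpow_le_rpow_of_exponent_ge' (ht i) hle zero_le_one hp
    _ = t i := Real.rpow_one _

theorem IsDensityMatrix.schattenNorm_one {σ : Matrix d d ℂ} (hσ : IsDensityMatrix σ) :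
    schattenNorm 1 σ = 1 := by
  obtain ⟨hpsd, htr⟩ := hσ
  obtain ⟨W, hW, t, ht, rfl⟩ := exists_eq_conj_realDiagonal hpsd
  rw [trace_conj_realDiagonal hW] at htr
  rw [schattenNorm_of_svd hW hW ht]
  simpa using (by exact_mod_cast htr : ∑ i, t i = 1)

theorem pure_mul_mul_pure {n : Type*} [Fintype n] (ψ : n → ℂ) (σ : Matrix n n ℂ) :
    Matrix.vecMulVec ψ (star ψ) * σ * Matrix.vecMulVec ψ (star ψ) =
      (Matrix.vecMulVec ψ (star ψ) * σ).trace • Matrix.vecMulVec ψ (star ψ) := by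
  rw [Matrix.vecMulVec_mul, Matrix.vecMulVec_mul_vecMulVec, Matrix.trace_vecMulVec,
    dotProduct_comm ψ, Matrix.vecMulVec_smul]

theorem normFidelity_of_isPureState {p : ℝ} (hp : 1 ≤ p) {ρ σ : Matrix d d ℂ}
    (hρ : IsDensityMatrix ρ) (hσ : IsDensityMatrix σ) (h : IsPureState ρ) :
    (normFidelity p ρ σ : ℂ) = (ρ * σ).trace := by
  have hp0 : 0 < p := by linarith
  have hsand : ∀ τ : Matrix d d ℂ, ρ * τ * ρ = (ρ * τ).trace • ρ := by
    obtain ⟨ψ, -, rfl⟩ := h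
    exact pure_mul_mul_pure ψ
  -- The sandwich identity at the identity matrix, with `tr ρ = 1`.
  have hidem : ρ * ρ = ρ := by
    have := hsand 1
    rwa [mul_one, hρ.2, one_smul] at this
  have hstar : ρᴴ = ρ := hρ.1.1
  have hsqrt : CFC.sqrt ρ = ρ := CFC.sqrt_unique hidem hρ.1.nonneg
  -- By idempotence the trace equals that of the positive semidefinite matrix `ρσρ`, so it is real
  -- and nonnegative.
  obtain ⟨c, hc, hcσ⟩ : ∃ c : ℝ, 0 ≤ c ∧ (ρ * σ).trace = (c : ℂ) := by
    have h1 : (ρ * σ).trace = (ρ * σ * ρᴴ).trace := by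
      rw [hstar, Matrix.trace_mul_comm (ρ * σ) ρ, ← mul_assoc, hidem]
    have h2 := (hσ.1.mul_mul_conjTranspose_same ρ).trace_nonneg
    rw [← h1] at h2
    obtain ⟨h3, h4⟩ := Complex.nonneg_iff.mp h2
    exact ⟨_, h3, Complex.ext rfl h4.symm⟩
  have hnρ : schattenNorm p ρ = 1 := by
    have h1 := trace_rpow_smul_projection hρ.1 hidem zero_le_one (r := p / 2) (by positivity)
    rw [Complex.ofReal_one, one_smul, Real.one_rpow, hρ.2, Complex.ofReal_one, one_mul] at h1
    rw [schattenNorm, hstar, hidem, h1, Complex.one_re, Real.one_rpow]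
  have hnM : schattenNorm p (ρ * CFC.sqrt σ) ^ 2 = c := by
    -- The left side is `ρσρ`: a multiple of a projection, whose powers have known trace.
    have h1 : ρ * CFC.sqrt σ * (ρ * CFC.sqrt σ)ᴴ = (c : ℂ) • ρ := by
      rw [Matrix.conjTranspose_mul, sqrt_conjTranspose, hstar, ← hcσ, ← hsand]
      nth_rewrite 3 [← sqrt_mul_sqrt hσ.1]
      simp only [mul_assoc]
    rw [schattenNorm, h1, trace_rpow_smul_projection hρ.1 hidem hc (by positivity), hρ.2, mul_one,
      Complex.ofReal_re, ← Real.rpow_natCast, ← Real.rpow_mul hc, ← Real.rpow_mul hc]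
    have : p / 2 * (1 / p) * ((2 : ℕ) : ℝ) = 1 := by
      push_cast
      field_simp
    rw [this, Real.rpow_one]
  have hmax : max (schattenNorm p ρ ^ 2) (schattenNorm p σ ^ 2) = 1 := by
    rw [hnρ, one_pow]
    exact max_eq_left (pow_le_one₀ (schattenNorm_nonneg _ _) (hσ.schattenNorm_le_one hp))
  rw [normFidelity, hsqrt, hnM, hmax, div_one, hcσ]

theorem jozsaAxioms_normFidelity {p : ℝ} (hp : 1 ≤ p) :
    JozsaAxioms (normFidelity (d := d) p) where
  j1a _ _ hρ hσ := normFidelity_mem_Icc hp hρ hσ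
  j1b _ _ hρ hσ := normFidelity_eq_one_iff hp hρ hσ
  j1c _ _ hρ hσ := normFidelity_eq_zero_iff hp hρ hσ
  j2 ρ σ _ _ := normFidelity_comm p ρ σ
  j3 ρ σ hρ hσ h := by
    rcases h with h | h
    · exact normFidelity_of_isPureState hp hρ hσ h
    · rw [normFidelity_comm, Matrix.trace_mul_comm]
      exact normFidelity_of_isPureState hp hσ hρ h
  j4 _ _ hρ hσ _ hU := normFidelity_unitary_conj p hρ.1 hσ.1 hU

/-! ### The case `p = 1`: trace formula -/

theorem normFidelity_one_of_svd {ρ σ : Matrix d d ℂ} (hρ : IsDensityMatrix ρ)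
    (hσ : IsDensityMatrix σ) {U V : Matrix d d ℂ} (hU : U ∈ Matrix.unitaryGroup d ℂ)
    (hV : V ∈ Matrix.unitaryGroup d ℂ) {s : d → ℝ} (hs : ∀ i, 0 ≤ s i)
    (hM : CFC.sqrt ρ * CFC.sqrt σ = U * realDiagonal s * Vᴴ) :
    normFidelity 1 ρ σ = (∑ i, s i) ^ 2 := by
  rw [normFidelity, hρ.schattenNorm_one, hσ.schattenNorm_one, hM, schattenNorm_of_svd hU hV hs]
  simp

theorem normFidelity_one_eq_trace_sqrt {ρ σ : Matrix d d ℂ} (hρ : IsDensityMatrix ρ)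
    (hσ : IsDensityMatrix σ) :
    (normFidelity 1 ρ σ : ℂ) = (CFC.sqrt (CFC.sqrt ρ * σ * CFC.sqrt ρ)).trace ^ 2 := by
  obtain ⟨U, hU, V, hV, s, hs, hM⟩ :=
    exists_singular_value_decomposition (CFC.sqrt ρ * CFC.sqrt σ)
  -- This matrix is `M Mᴴ` for `M = √ρ √σ`, so its eigenvalues are the squared singular values.
  have h1 : CFC.sqrt ρ * σ * CFC.sqrt ρ = U * realDiagonal (fun i => s i ^ 2) * Uᴴ := by
    rw [← mul_conjTranspose_of_svd hV, ← hM, Matrix.conjTranspose_mul, sqrt_conjTranspose,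
      sqrt_conjTranspose]
    nth_rewrite 1 [← sqrt_mul_sqrt hσ.1]
    simp only [mul_assoc]
  rw [h1, CFC.sqrt_eq_rpow, trace_rpow_conj_realDiagonal hU (fun i => sq_nonneg _),
    normFidelity_one_of_svd hρ hσ hU hV hs hM]
  have h2 : ∀ i, (s i ^ 2) ^ (1 / 2 : ℝ) = s i := fun i => by
    rw [← Real.sqrt_eq_rpow, Real.sqrt_sq (hs i)]
  simp only [h2, Complex.ofReal_pow]

/-! ### Purifications and the variational formula -/

/-- A matrix `Ψ` factors through the square root of `Ψ Ψᴴ` by a contraction. -/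
theorem exists_eq_sqrt_mul_contraction {e : Type*} [Fintype e] (Ψ : Matrix d e ℂ) :
    ∃ X : Matrix d e ℂ, Ψ = CFC.sqrt (Ψ * Ψᴴ) * X ∧ (1 - X * Xᴴ).PosSemidef := by
  obtain ⟨W, hW, a, ha, hA⟩ := exists_eq_conj_realDiagonal (sqrt_posSemidef (Ψ * Ψᴴ))
  have hWW := conjTranspose_mul_self_of_mem hW
  have hWW' := mul_conjTranspose_self_of_mem hW
  have hΨ : (Wᴴ * Ψ) * (Wᴴ * Ψ)ᴴ = realDiagonal fun i => a i ^ 2 := by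
    have h1 := sqrt_mul_sqrt (Matrix.posSemidef_self_mul_conjTranspose Ψ)
    rw [hA] at h1
    calc (Wᴴ * Ψ) * (Wᴴ * Ψ)ᴴ = Wᴴ * (Ψ * Ψᴴ) * W := by
          simp only [Matrix.conjTranspose_mul, Matrix.conjTranspose_conjTranspose, Matrix.mul_assoc]
      _ = (Wᴴ * W) * realDiagonal a * (Wᴴ * W) * realDiagonal a * (Wᴴ * W) := by
          rw [← h1]
          simp only [Matrix.mul_assoc]
      _ = _ := by simp [hWW, realDiagonal, sq]
  set Θ := Wᴴ * Ψ with hΘ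
  have hWΘ : W * Θ = Ψ := by rw [hΘ, ← Matrix.mul_assoc, hWW', Matrix.one_mul]
  -- The pseudo-inverse of the diagonal matrix of `a`, since `0⁻¹ = 0`.
  let b : Matrix d d ℂ := realDiagonal fun i => (a i)⁻¹
  have hb : bᴴ = b := conjTranspose_realDiagonal _
  refine ⟨W * (b * Θ), ?_, ?_⟩
  · have h0 : realDiagonal a * b * Θ = Θ := by
      ext i k
      rw [Matrix.diagonal_mul_diagonal, Matrix.diagonal_mul]
      -- If `a i = 0`, row `i` of `Θ` has squared norm `a i ^ 2 = 0`, so nothing is lost by the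
      -- pseudo-inverse.
      by_cases h : a i = 0
      · have h2 := congrFun (congrFun hΨ i) i
        simp only [realDiagonal, Matrix.diagonal_apply_eq, Matrix.mul_apply, h] at h2
        have h3 : ∑ k, ‖Θ i k‖ ^ 2 = 0 := by
          have : ((∑ k, ‖Θ i k‖ ^ 2 : ℝ) : ℂ) = 0 := by
            rw [← Complex.ofReal_zero, ← zero_pow two_ne_zero, ← h2]
            push_cast
            refine Finset.sum_congr rfl fun k _ => ?_
            rw [Matrix.conjTranspose_apply, RCLike.star_def, Complex.mul_conj']
          exact_mod_cast this
        rw [Finset.sum_eq_zero_iff_of_nonneg (fun _ _ => by positivity)] at h3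
        have h4 := h3 k (Finset.mem_univ k)
        have h5 : Θ i k = 0 := by simpa using h4
        rw [h5, mul_zero]
      · have h' : (a i : ℂ) ≠ 0 := by exact_mod_cast h
        push_cast
        rw [mul_inv_cancel₀ h', one_mul]
    calc Ψ = W * (realDiagonal a * b * Θ) := by rw [h0, hWΘ]
      _ = W * realDiagonal a * (Wᴴ * W) * (b * Θ) := by
        rw [hWW]
        simp only [Matrix.mul_assoc, Matrix.mul_one]
      _ = _ := by
        rw [hA]
        simp only [Matrix.mul_assoc]
  · have h1 : W * (b * Θ) * (W * (b * Θ))ᴴ =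
        W * realDiagonal (fun i => (a i)⁻¹ * a i ^ 2 * (a i)⁻¹) * Wᴴ := by
      calc W * (b * Θ) * (W * (b * Θ))ᴴ = W * (b * (Θ * Θᴴ) * b) * Wᴴ := by
            simp only [Matrix.conjTranspose_mul, hb, Matrix.mul_assoc]
        _ = _ := by
            rw [hΨ]
            simp [b, realDiagonal, Matrix.diagonal_mul_diagonal]
    have h2 : 1 - W * (b * Θ) * (W * (b * Θ))ᴴ =
        W * realDiagonal (fun i => 1 - (a i)⁻¹ * a i ^ 2 * (a i)⁻¹) * Wᴴ := by
      have : realDiagonal (fun i => 1 - (a i)⁻¹ * a i ^ 2 * (a i)⁻¹) =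
          1 - realDiagonal (fun i => (a i)⁻¹ * a i ^ 2 * (a i)⁻¹) := by
        rw [← Matrix.diagonal_one, Matrix.diagonal_sub]
        simp [realDiagonal]
      rw [this, h1, mul_sub, sub_mul, mul_one, hWW']
    rw [h2]
    refine posSemidef_conj_realDiagonal W fun i => ?_
    -- The diagonal entry is 1 where `a i = 0` and 0 elsewhere: `X * Xᴴ` is the projection onto the
    -- range of the root.
    by_cases h : a i = 0
    · simp [h]
    · field_simp
      simp

theorem sum_norm_sq_row_le_one {e : Type*} [Fintype e] {X : Matrix d e ℂ}
    (hX : (1 - X * Xᴴ).PosSemidef) {U : Matrix d d ℂ} (hU : U ∈ Matrix.unitaryGroup d ℂ) (i : d) :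
    ∑ k, ‖(Uᴴ * X) i k‖ ^ 2 ≤ 1 := by
  have h1 : Uᴴ * (1 - X * Xᴴ) * U = 1 - (Uᴴ * X) * (Uᴴ * X)ᴴ := by
    rw [mul_sub, sub_mul, mul_one, conjTranspose_mul_self_of_mem hU]
    simp only [Matrix.conjTranspose_mul, Matrix.conjTranspose_conjTranspose, Matrix.mul_assoc]
  have h2 := re_diag_nonneg (hX.conjTranspose_mul_mul_same U) i
  rw [h1, Matrix.sub_apply, Matrix.one_apply_eq, Complex.sub_re, Complex.one_re, Matrix.mul_apply,
    Complex.re_sum] at h2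
  have h3 : ∑ k, ((Uᴴ * X) i k * (Uᴴ * X)ᴴ k i).re = ∑ k, ‖(Uᴴ * X) i k‖ ^ 2 := by
    refine Finset.sum_congr rfl fun k _ => ?_
    rw [Matrix.conjTranspose_apply, RCLike.star_def, Complex.mul_conj', ← Complex.ofReal_pow,
      Complex.ofReal_re]
  linarith

theorem norm_mul_conjTranspose_diag_le {n e : Type*} [Fintype e] {P Q : Matrix n e ℂ} {i : n}
    (hP : ∑ k, ‖P i k‖ ^ 2 ≤ 1) (hQ : ∑ k, ‖Q i k‖ ^ 2 ≤ 1) : ‖(P * Qᴴ) i i‖ ≤ 1 := by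
  rw [Matrix.mul_apply]
  calc _ ≤ ∑ k, ‖P i k * Qᴴ k i‖ := norm_sum_le _ _
    _ ≤ ∑ k, (‖P i k‖ ^ 2 + ‖Q i k‖ ^ 2) / 2 := by
      refine Finset.sum_le_sum fun k _ => ?_
      rw [norm_mul, Matrix.conjTranspose_apply, norm_star]
      linarith [two_mul_le_add_sq ‖P i k‖ ‖Q i k‖]
    _ = (∑ k, ‖P i k‖ ^ 2 + ∑ k, ‖Q i k‖ ^ 2) / 2 := by
      rw [← Finset.sum_add_distrib, Finset.sum_div]
    _ ≤ 1 := by linarith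

/-- The overlap of two purifications is at most the sum of the singular values of `√ρ √σ`. -/
theorem norm_trace_conjTranspose_mul_le {e : Type*} [Fintype e] (Ψ Φ : Matrix d e ℂ)
    {U V : Matrix d d ℂ} (hU : U ∈ Matrix.unitaryGroup d ℂ) (hV : V ∈ Matrix.unitaryGroup d ℂ)
    {s : d → ℝ} (hs : ∀ i, 0 ≤ s i)
    (hM : CFC.sqrt (Ψ * Ψᴴ) * CFC.sqrt (Φ * Φᴴ) = U * realDiagonal s * Vᴴ) :
    ‖(Ψᴴ * Φ).trace‖ ≤ ∑ i, s i := by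
  obtain ⟨X, hX, hXc⟩ := exists_eq_sqrt_mul_contraction Ψ
  obtain ⟨Y, hY, hYc⟩ := exists_eq_sqrt_mul_contraction Φ
  have h1 : (Ψᴴ * Φ).trace = (realDiagonal s * ((Vᴴ * Y) * (Uᴴ * X)ᴴ)).trace := by
    calc (Ψᴴ * Φ).trace = (Xᴴ * ((CFC.sqrt (Ψ * Ψᴴ) * CFC.sqrt (Φ * Φᴴ)) * Y)).trace := by
          conv_lhs => rw [hX, hY]
          rw [Matrix.conjTranspose_mul, sqrt_conjTranspose]
          simp only [Matrix.mul_assoc]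
      _ = ((Xᴴ * U) * (realDiagonal s * (Vᴴ * Y))).trace := by
          rw [hM]
          simp only [Matrix.mul_assoc]
      _ = _ := by
          rw [Matrix.trace_mul_comm, Matrix.conjTranspose_mul, Matrix.conjTranspose_conjTranspose]
          simp only [Matrix.mul_assoc]
  rw [h1, Matrix.trace]
  refine (norm_sum_le _ _).trans (Finset.sum_le_sum fun i _ => ?_)
  rw [Matrix.diag_apply, Matrix.diagonal_mul, norm_mul, Complex.norm_real, Real.norm_of_nonneg (hs i)]
  exact mul_le_of_le_one_right (hs i) (norm_mul_conjTranspose_diag_le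
    (sum_norm_sq_row_le_one hYc hV i) (sum_norm_sq_row_le_one hXc hU i))

/-- Reshaping a vector of the tensor product into a matrix turns the partial trace of its projector
into a product with the adjoint, entry by entry. -/
theorem isPurification_iff {n e : Type*} [Fintype e] {ψ : n × e → ℂ} {ρ : Matrix n n ℂ} :
    IsPurification ψ ρ ↔
      (Matrix.of fun i k => ψ (i, k)) * (Matrix.of fun i k => ψ (i, k))ᴴ = ρ := Iff.rfl

theorem star_dotProduct_eq_trace {n e : Type*} [Fintype n] [Fintype e] (ψ φ : n × e → ℂ) :
    star ψ ⬝ᵥ φ =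
      ((Matrix.of fun i k => ψ (i, k))ᴴ * (Matrix.of fun i k => φ (i, k))).trace := by
  simp only [dotProduct, Matrix.trace, Matrix.diag_apply, Matrix.mul_apply,
    Matrix.conjTranspose_apply, Matrix.of_apply, Pi.star_apply, Fintype.sum_prod_type]
  exact Finset.sum_comm

theorem isGreatest_transitionProbabilities {ρ σ : Matrix d d ℂ} (hρ : IsDensityMatrix ρ)
    (hσ : IsDensityMatrix σ) :
    IsGreatest (transitionProbabilities ρ σ) (normFidelity 1 ρ σ) := by
  obtain ⟨U, hU, V, hV, s, hs, hM⟩ :=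
    exists_singular_value_decomposition (CFC.sqrt ρ * CFC.sqrt σ)
  rw [normFidelity_one_of_svd hρ hσ hU hV hs hM]
  constructor
  · let E := Fintype.equivFin d
    have hQ : V * Uᴴ ∈ Matrix.unitaryGroup d ℂ := mul_mem hV (conjTranspose_mem hU)
    let Ψ : Matrix d (Fin (Fintype.card d)) ℂ := (CFC.sqrt ρ).submatrix id E.symm
    -- The factor `V * Uᴴ` undoes the polar phase: `√ρ √σ V U† = U S U†` has trace `∑ i, s i`. An
    -- auxiliary space of dimension `Fintype.card d` suffices.
    let Φ : Matrix d (Fin (Fintype.card d)) ℂ := (CFC.sqrt σ * (V * Uᴴ)).submatrix id E.symm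
    refine ⟨_, fun x => Ψ x.1 x.2, fun x => Φ x.1 x.2, ?_, ?_, ?_⟩
    · rw [isPurification_iff]
      change Ψ * Ψᴴ = ρ
      rw [Matrix.conjTranspose_submatrix, Matrix.submatrix_mul_equiv, Matrix.submatrix_id_id,
        sqrt_conjTranspose, sqrt_mul_sqrt hρ.1]
    · rw [isPurification_iff]
      change Φ * Φᴴ = σ
      rw [Matrix.conjTranspose_submatrix, Matrix.submatrix_mul_equiv, Matrix.submatrix_id_id,
        Matrix.conjTranspose_mul, sqrt_conjTranspose]
      calc _ = CFC.sqrt σ * ((V * Uᴴ) * (V * Uᴴ)ᴴ) * CFC.sqrt σ := by simp only [mul_assoc]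
        _ = _ := by rw [mul_conjTranspose_self_of_mem hQ, mul_one, sqrt_mul_sqrt hσ.1]
    · rw [star_dotProduct_eq_trace]
      change _ = ‖(Ψᴴ * Φ).trace‖ ^ 2
      have h1 : (Ψᴴ * Φ).trace = ((∑ i, s i : ℝ) : ℂ) := by
        rw [Matrix.trace_mul_comm, Matrix.conjTranspose_submatrix, Matrix.submatrix_mul_equiv,
          Matrix.submatrix_id_id, sqrt_conjTranspose, Matrix.trace_mul_comm, ← mul_assoc, hM,
          ← trace_conj_realDiagonal hU]
        congr 1
        calc _ = U * realDiagonal s * (Vᴴ * V) * Uᴴ := by simp only [mul_assoc]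
          _ = _ := by rw [conjTranspose_mul_self_of_mem hV, mul_one]
      rw [h1, Complex.norm_real, Real.norm_eq_abs, sq_abs]
  · rintro x ⟨m, ψ, φ, hψ, hφ, rfl⟩
    rw [isPurification_iff] at hψ hφ
    rw [star_dotProduct_eq_trace]
    gcongr
    refine norm_trace_conjTranspose_mul_le _ _ hU hV hs ?_
    rw [hψ, hφ, hM]

end NormFidelity

open NormFidelity in
theorem mainTheorem1 {d : Type*} [Fintype d] [DecidableEq d] :
    (∀ p : ℝ, 1 ≤ p → JozsaAxioms (normFidelity (d := d) p)) ∧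
    ∀ ρ σ : Matrix d d ℂ, IsDensityMatrix ρ → IsDensityMatrix σ →
      IsGreatest (transitionProbabilities ρ σ) (normFidelity 1 ρ σ) ∧
      (normFidelity 1 ρ σ : ℂ) =
        (CFC.sqrt (CFC.sqrt ρ * σ * CFC.sqrt ρ)).trace ^ 2 :=
  ⟨fun _ hp => jozsaAxioms_normFidelity hp, fun _ _ hρ hσ =>
    ⟨isGreatest_transitionProbabilities hρ hσ, normFidelity_one_eq_trace_sqrt hρ hσ⟩⟩
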